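/- Let $\mathcal S$ and $\mathcal A$ be finite nonempty sets. A Markov decision process (MDP) $M=(\mathcal S,\mathcal A,\bar r,p,s_1)$ consists of mean rewards $\bar r(s,a)\in[0,1]$, transition probabilities $p(\cdot\mid s,a)$ on $\mathcal S$, and an initial state $s_1\in\mathcal S$. For a stationary policy $\pi:\mathcal S\to\mathcal A$ and a start state $s$, let $s=s_1',s_2',\dots$ be the Markov chain obtained by playing $\pi$ in $M$ from $s$, and let $$\rho(M,\pi,s)=\lim_{T\to\infty}\frac1T\,\mathbb E\Big[\sum_{t=1}^{T}\bar r\big(s_t',\pi(s_t')\big)\Big],\qquad \rho^*(M)=\max_{\pi}\rho(M,\pi,s_1).$$ A policy is optimal if it maximizes $\rho(M,\cdot,s)$ for every $s$. $M$ is communicating if from every state every other state can be reached with positive probability by choosing appropriate actions. The diameter of $M$ is $\max_{s\ne s'}\min_{\pi}\mathbb E[\tau_{s'}\mid M,\pi,s]$, where $\tau_{s'}$ is the number of steps until $s'$ is first reached from $s$, and the maximum over the empty set is $0$. (0) The limit $\rho(M,\pi,s)$ exists for all $M$, $\pi$, $s$. (1) Let $T\ge 0$ be an integer and let $M_t=(\mathcal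 S,\mathcal A,\bar r_t,p_t,s_1)$, $t=1,\dots,T$, be communicating MDPs with a common initial state, all of diameter at most $D<\infty$. Put $$V_T=\sum_{t=1}^{T-1}\big|\rho^*(M_{t+1})-\rho^*(M_t)\big|,\quad V_T^r=\sum_{t=1}^{T-1}\max_{s,a}\big|\bar r_{t+1}(s,a)-\bar r_t(s,a)\big|,\quad V_T^p=\sum_{t=1}^{T-1}\max_{s,a}\big\|p_{t+1}(\cdot\mid s,a)-p_t(\cdot\mid s,a)\big\|_1 .$$ Then $V_T\le V_T^r+D\,V_T^p$. (2) Let $M=(\mathcal S,\mathcal A,\bar r,p,s_1)$ and $M'=(\mathcal S,\mathcal A,\bar r',p',s_1)$ be communicating MDPs and let $\pi'$ be an optimal policy for $M'$. Then there is a function $\lambda':\mathcal S\to\mathbb R$ (a bias function of $\pi'$) that solves the Poisson equation $$\rho^*(M')-\bar r'(s,\pi'(s))=\sum_{s'}p'(s'\mid s,\pi'(s))\,\lambda'(s')-\lambda'(s)\qquad(s\in\mathcal S),$$ and for every such $\lambda'$, with span $\Lambda'=\max_s\lambda'(s)-\min_s\lambda'(s)$, and all real $\Delta^r,\Delta^p$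 such that $|\bar r(s,\pi'(s))-\bar r'(s,\pi'(s))|\le\Delta^r$ and $\|p(\cdot\mid s,\pi'(s))-p'(\cdot\mid s,\pi'(s))\|_1\le\Delta^p$ for all $s$, $$\rho^*(M')-\rho^*(M)\le\Lambda'\Delta^p+\Delta^r .$$ -/

import Mathlib

open MeasureTheory ProbabilityTheory Filter Topology
open scoped ENNReal NNReal

/-- A Markov decision process with state space `S` and action space `A`: mean rewards in `[0,1]`,
transition probabilities `p(· | s, a)`, and an initial state. -/
structure MDP (S A : Type*) where
  /-- The mean reward of action `a` in state `s`. -/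
  reward : S → A → ℝ
  /-- The distribution of the next state after action `a` in state `s`. -/
  trans : S → A → PMF S
  /-- The initial state. -/
  init : S
  reward_mem : ∀ s a, reward s a ∈ Set.Icc (0 : ℝ) 1

namespace MDP

section Basic

variable {S A : Type*}

/-- The transition probability `p(s' | s, a)` as a real number. -/
noncomputable def prob (M : MDP S A) (s : S) (a : A) (s' : S) : ℝ :=
  (M.trans s a s').toReal

/-- `M` is communicating: from every state every state can be reached with positive probability
(in finitely many steps, zero included) by choosing appropriate actions. -/
def IsCommunicating (M : MDP S A) : Prop :=
  ∀ s s' : S, Relation.ReflTransGen (fun x y => ∃ a, 0 < M.prob x a y) s s'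

/-- The first time at which the trajectory `ω` is in state `s'` (`∞` if this never happens). -/
noncomputable def hittingTime (s' : S) (ω : ℕ → S) : ℝ≥0∞ :=
  ⨅ (n : ℕ) (_ : ω n = s'), (n : ℝ≥0∞)

/-- The `L¹` distance of `p(· | s, a)` in `M` and `p(· | s, a)` in `M'`. -/
noncomputable def transDist [Fintype S] (M M' : MDP S A) (s : S) (a : A) : ℝ :=
  ∑ s', |M.prob s a s' - M'.prob s a s'|

/-- The span `max f - min f` of a function on the (finite) state space. -/
noncomputable def span (f : S → ℝ) : ℝ := (⨆ s, f s) - ⨅ s, f s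

/-- The variation of the mean rewards of `M 1, …, M T`. -/
noncomputable def rewardVariation (M : ℕ → MDP S A) (T : ℕ) : ℝ :=
  ∑ t ∈ Finset.Ico 1 T, ⨆ x : S × A, |(M (t + 1)).reward x.1 x.2 - (M t).reward x.1 x.2|

/-- The variation of the transition probabilities of `M 1, …, M T`. -/
noncomputable def transVariation [Fintype S] (M : ℕ → MDP S A) (T : ℕ) : ℝ :=
  ∑ t ∈ Finset.Ico 1 T, ⨆ x : S × A, transDist (M (t + 1)) (M t) x.1 x.2

end Basic

section Dynamics

variable {S A : Type*} [Fintype S] [MeasurableSpace S] [MeasurableSingletonClass S]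

/-- Given the states at times `0, …, n`, the law of the state at time `n + 1` when the stationary
policy `π` is followed. -/
noncomputable def stepKernel (M : MDP S A) (π : S → A) (n : ℕ) :
    Kernel ((i : Finset.Iic n) → (fun _ : ℕ => S) i) S :=
  Kernel.ofFunOfCountable fun h =>
    (M.trans (h ⟨n, Finset.mem_Iic.2 le_rfl⟩) (π (h ⟨n, Finset.mem_Iic.2 le_rfl⟩))).toMeasure

instance (M : MDP S A) (π : S → A) (n : ℕ) : IsMarkovKernel (M.stepKernel π n) :=
  ⟨fun h => PMF.toMeasure.isProbabilityMeasure
    (M.trans (h ⟨n, Finset.mem_Iic.2 le_rfl⟩) (π (h ⟨n, Finset.mem_Iic.2 le_rfl⟩)))⟩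

/-- The law of the state trajectory `ω 0, ω 1, …` when the stationary policy `π` is followed in `M`
from the state `ω 0 = s`. (The state visited at step `t = 1, 2, …` is `ω (t - 1)`.) -/
noncomputable def pathLaw (M : MDP S A) (π : S → A) (s : S) : Measure (ℕ → S) :=
  Kernel.traj (X := fun _ => S) (M.stepKernel π) 0 (fun _ => s)

/-- The expected average reward in the first `T` steps under `π`, started in `s`. -/
noncomputable def avgReward (M : MDP S A) (π : S → A) (s : S) (T : ℕ) : ℝ :=
  (1 / (T : ℝ)) * ∫ ω, ∑ t ∈ Finset.range T, M.reward (ω t) (π (ω t)) ∂(M.pathLaw π s)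

/-- The average reward (gain) of the stationary policy `π`, started in `s`. -/
noncomputable def gain (M : MDP S A) (π : S → A) (s : S) : ℝ :=
  limUnder atTop (M.avgReward π s)

/-- The optimal average reward `ρ*(M) = max_π ρ(M, π)` (from the initial state of `M`). -/
noncomputable def optGain (M : MDP S A) : ℝ := ⨆ π : S → A, M.gain π M.init

/-- The stationary policy `π` is optimal (from every state). -/
def IsOptimal (M : MDP S A) (π : S → A) : Prop :=
  ∀ (s : S) (π' : S → A), M.gain π' s ≤ M.gain π s

/-- `h` is a bias function of the optimal policy `π`: it solves the Poisson equation. -/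
def IsBias (M : MDP S A) (π : S → A) (h : S → ℝ) : Prop :=
  ∀ s, M.optGain - M.reward s (π s) = ∑ s', M.prob s (π s) s' * h s' - h s

/-- The diameter: the largest, over pairs of distinct states, of the minimal (over stationary
policies) expected time to get from the one to the other. -/
noncomputable def diameter (M : MDP S A) : ℝ≥0∞ :=
  ⨆ (s : S) (s' : S) (_ : s ≠ s'), ⨅ π : S → A, ∫⁻ ω, hittingTime s' ω ∂(M.pathLaw π s)

/-- The variation `V_T` of the optimal average rewards of `M 1, …, M T`. -/
noncomputable def gainVariation (M : ℕ → MDP S A) (T : ℕ) : ℝ :=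
  ∑ t ∈ Finset.Ico 1 T, |(M (t + 1)).optGain - (M t).optGain|

end Dynamics

end MDP

/-!
A stationary policy `π` induces a Markov chain with transition operator `P` on functions of the
state, and its reward `r` is averaged along that chain. The powers of `P` are bounded, so the
kernel and the range of `1 - P` are complementary and `r = g + h - P h` with `P g = g`
(`exists_poisson_decomposition`); the averages of `h - P h` telescope to zero, so the average reward
converges to `g`. By the same telescoping, a constant `c ≤ r + P h - h` is a lower bound for the
gain and a constant `c ≥ r + P h - h` an upper bound (`le_gain`, `gain_le`).

Perturbation bound: if `π` is optimal, no action in any state raises the expected gain of the next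
state (`IsOptimal.sum_prob_mul_gain_le`, by policy improvement). Hence the states of minimal gain
cannot be left, and communication makes the gain constant; the Poisson equation of `π` then provides
the bias function. Passing from `M'` to `M` under `π` changes `r + P h - h` by at most
`Δr + span h * Δp`, so the gain of `π` in `M` is at least `ρ*(M')` minus that amount
(`le_gain_of_perturbation`).

Variation bound: instead of an optimal bias function of span at most the diameter `D`, the value
function `v` of the `β`-discounted problem is used. Going to a state `s'` first loses at most one
unit of reward per step, so `v s' - v s` is at most the expected hitting time of `s'` from `s` under
any policy (`ofReal_le_lintegral_hittingTime`), and the span of `v` is at most `D` for every `β`. A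
greedy policy satisfies `r + P v - v = (1 - β) P v`, which is within `(1 - β) D` of the upper bound
`(1 - β) max v` for the optimal gain. The perturbation bound for `v` in place of a bias function,
in the limit `β → 1`, bounds each summand of the variation (`optGain_sub_le_of_diameter_le`).
-/

namespace MDP

/-! ### The transition operator of a stationary policy -/

section TransOp

variable {S A : Type*}

lemma prob_nonneg (M : MDP S A) (s : S) (a : A) (s' : S) : 0 ≤ M.prob s a s' :=
  ENNReal.toReal_nonneg

variable [Fintype S]

lemma sum_prob (M : MDP S A) (s : S) (a : A) : ∑ s', M.prob s a s' = 1 := by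
  have h := (M.trans s a).tsum_coe
  rw [tsum_fintype] at h
  unfold prob
  rw [← ENNReal.toReal_sum fun x _ => (M.trans s a).apply_ne_top x, h, ENNReal.toReal_one]

lemma sum_prob_mul_mono (M : MDP S A) (s : S) (a : A) {f g : S → ℝ} (h : ∀ x, f x ≤ g x) :
    ∑ s', M.prob s a s' * f s' ≤ ∑ s', M.prob s a s' * g s' :=
  Finset.sum_le_sum fun x _ => mul_le_mul_of_nonneg_left (h x) (M.prob_nonneg s a x)

lemma sum_prob_mul_const (M : MDP S A) (s : S) (a : A) (c : ℝ) :
    ∑ s', M.prob s a s' * c = c := by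
  rw [← Finset.sum_mul, sum_prob, one_mul]

lemma abs_sum_prob_mul_le (M : MDP S A) (s : S) (a : A) {f : S → ℝ} {c : ℝ}
    (h : ∀ x, |f x| ≤ c) : |∑ s', M.prob s a s' * f s'| ≤ c := by
  rw [abs_le]
  constructor
  · rw [← M.sum_prob_mul_const s a (-c)]
    exact M.sum_prob_mul_mono s a fun x => (abs_le.1 (h x)).1
  · rw [← M.sum_prob_mul_const s a c]
    exact M.sum_prob_mul_mono s a fun x => (abs_le.1 (h x)).2

lemma transDist_comm (M M' : MDP S A) (s : S) (a : A) : transDist M M' s a = transDist M' M s a :=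
  Finset.sum_congr rfl fun _ _ => abs_sub_comm _ _

lemma sub_le_span (f : S → ℝ) (x y : S) : f x - f y ≤ span f :=
  sub_le_sub (le_ciSup (Set.finite_range f).bddAbove x) (ciInf_le (Set.finite_range f).bddBelow y)

/-- The transition operator of the Markov chain that `π` induces in `M`: it maps `f` to the expected
value of `f` at the next state. -/
noncomputable def transOp (M : MDP S A) (π : S → A) : Module.End ℝ (S → ℝ) where
  toFun f s := ∑ s', M.prob s (π s) s' * f s'
  map_add' f g := by
    ext s
    simp [mul_add, Finset.sum_add_distrib]
  map_smul' c f := by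
    ext s
    simp only [Pi.smul_apply, smul_eq_mul, RingHom.id_apply, Finset.mul_sum]
    exact Finset.sum_congr rfl fun x _ => by ring

lemma transOp_apply (M : MDP S A) (π : S → A) (f : S → ℝ) (s : S) :
    M.transOp π f s = ∑ s', M.prob s (π s) s' * f s' := rfl

lemma transOp_mono (M : MDP S A) (π : S → A) {f g : S → ℝ} (h : f ≤ g) :
    M.transOp π f ≤ M.transOp π g := fun s => M.sum_prob_mul_mono s (π s) h

lemma transOp_const (M : MDP S A) (π : S → A) (c : ℝ) :
    M.transOp π (fun _ => c) = fun _ => c :=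
  funext fun s => M.sum_prob_mul_const s (π s) c

lemma transOp_pow_mono (M : MDP S A) (π : S → A) (n : ℕ) {f g : S → ℝ} (h : f ≤ g) :
    (M.transOp π ^ n) f ≤ (M.transOp π ^ n) g := by
  induction n with
  | zero => simpa using h
  | succ n ih =>
    rw [pow_succ', Module.End.mul_apply, Module.End.mul_apply]
    exact M.transOp_mono π ih

lemma le_transOp_pow (M : MDP S A) (π : S → A) (n : ℕ) {f : S → ℝ} (h : f ≤ M.transOp π f) :
    f ≤ (M.transOp π ^ n) f := by
  induction n with
  | zero => simp
  | succ n ih =>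
    rw [pow_succ', Module.End.mul_apply]
    exact h.trans (M.transOp_mono π ih)

lemma abs_transOp_pow_le (M : MDP S A) (π : S → A) (n : ℕ) (f : S → ℝ) (s : S) :
    |(M.transOp π ^ n) f s| ≤ ‖f‖ := by
  induction n generalizing s with
  | zero => simpa using norm_le_pi_norm f s
  | succ n ih =>
    rw [pow_succ', Module.End.mul_apply]
    exact M.abs_sum_prob_mul_le s (π s) ih

/-- The powers of the transition operator are bounded, so `u = P u` and `u = h - P h` together
force `P ^ n h = h - n u` and hence `u = 0`; by rank-nullity the kernel and the range of `1 - P`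
then span the whole space. -/
lemma exists_poisson_decomposition (M : MDP S A) (π : S → A) (r : S → ℝ) :
    ∃ g h : S → ℝ, M.transOp π g = g ∧ r = g + h - M.transOp π h := by
  set P := M.transOp π with hP
  have hdisj : Disjoint (LinearMap.range (1 - P)) (LinearMap.ker (1 - P)) := by
    rw [Submodule.disjoint_def]
    rintro u ⟨h, hu⟩ hk
    have hPu : P u = u := by
      have : u - P u = 0 := by simpa using hk
      exact (sub_eq_zero.1 this).symm
    have hPh : P h = h - u := by
      have : h - P h = u := by simpa using hu
      rw [← this]
      abel
    have hn : ∀ n : ℕ, (P ^ n) h = h - (n : ℝ) • u := by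
      intro n
      induction n with
      | zero => simp
      | succ n ih =>
        rw [pow_succ', Module.End.mul_apply, ih, map_sub, map_smul, hPu, hPh]
        push_cast
        module
    ext s
    by_contra hs
    have hpos : 0 < |u s| := abs_pos.2 hs
    obtain ⟨n, hlt⟩ := exists_nat_gt ((‖h‖ + ‖h‖) / |u s|)
    rw [div_lt_iff₀ hpos] at hlt
    have h1 := M.abs_transOp_pow_le π n h s
    have h2 : |h s| ≤ ‖h‖ := norm_le_pi_norm h s
    rw [← hP, hn] at h1
    simp only [Pi.sub_apply, Pi.smul_apply, smul_eq_mul] at h1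
    have h3 : (n : ℝ) * |u s| = |h s - (h s - n * u s)| := by
      rw [sub_sub_cancel, abs_mul, Nat.abs_cast]
    have h4 := abs_sub (h s) (h s - n * u s)
    linarith
  have htop : LinearMap.range (1 - P) ⊔ LinearMap.ker (1 - P) = ⊤ :=
    Submodule.eq_top_of_disjoint _ _ (LinearMap.finrank_range_add_finrank_ker (1 - P)).ge hdisj
  obtain ⟨_, ⟨h, rfl⟩, g, hg, hr⟩ := Submodule.mem_sup.1 (htop ▸ Submodule.mem_top (x := r))
  refine ⟨g, h, ?_, ?_⟩
  · have : g - P g = 0 := by simpa using hg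
    exact (sub_eq_zero.1 this).symm
  · rw [← hr]
    simp only [LinearMap.sub_apply, Module.End.one_apply]
    abel

lemma sum_transOp_pow_sub (M : MDP S A) (π : S → A) (h : S → ℝ) (T : ℕ) :
    ∑ t ∈ Finset.range T, (M.transOp π ^ t) (h - M.transOp π h) = h - (M.transOp π ^ T) h := by
  have : ∀ t, (M.transOp π ^ t) (h - M.transOp π h)
      = (M.transOp π ^ t) h - (M.transOp π ^ (t + 1)) h := fun t => by
    rw [map_sub, pow_succ, Module.End.mul_apply]
  simp_rw [this]
  simpa using Finset.sum_range_sub' (fun t => (M.transOp π ^ t) h) T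

/-- The boundary term of the telescoped Poisson equation is bounded, so it vanishes on average. -/
lemma tendsto_boundary (M : MDP S A) (π : S → A) (h : S → ℝ) (s : S) :
    Tendsto (fun T : ℕ => (1 / (T : ℝ)) * (h - (M.transOp π ^ T) h) s) atTop (𝓝 0) := by
  refine squeeze_zero_norm (a := fun T : ℕ => (1 / (T : ℝ)) * (2 * ‖h‖)) (fun T => ?_) ?_
  · rw [norm_mul, Real.norm_of_nonneg (by positivity : (0 : ℝ) ≤ 1 / T)]
    refine mul_le_mul_of_nonneg_left ?_ (by positivity)
    have h1 := M.abs_transOp_pow_le π T h s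
    have h2 : |h s| ≤ ‖h‖ := norm_le_pi_norm h s
    have h3 := abs_sub (h s) ((M.transOp π ^ T) h s)
    rw [Real.norm_eq_abs, Pi.sub_apply]
    linarith
  · simpa using (tendsto_one_div_atTop_nhds_zero_nat (𝕜 := ℝ)).mul_const (2 * ‖h‖)

/-- The Cesàro average of `r` along the Markov chain of `π`, started in `s`. -/
noncomputable def cesaro (M : MDP S A) (π : S → A) (r : S → ℝ) (s : S) (T : ℕ) : ℝ :=
  (1 / (T : ℝ)) * (∑ t ∈ Finset.range T, (M.transOp π ^ t) r) s

/-- The average of `r` dominates a subharmonic `f` (constant functions included) with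
`f + h ≤ r + P h`: apply `P ^ t` to the inequality, sum over `t < T` and telescope. -/
lemma le_of_tendsto_cesaro (M : MDP S A) (π : S → A) {f h r : S → ℝ} {s : S} {g : ℝ}
    (hf : f ≤ M.transOp π f) (hr : f ≤ r + M.transOp π h - h)
    (hg : Tendsto (M.cesaro π r s) atTop (𝓝 g)) : f s ≤ g := by
  have hlim : Tendsto (fun T : ℕ => f s + (1 / (T : ℝ)) * (h - (M.transOp π ^ T) h) s)
      atTop (𝓝 (f s)) := by
    simpa using (M.tendsto_boundary π h s).const_add (f s)
  refine le_of_tendsto_of_tendsto hlim hg ?_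
  filter_upwards [eventually_gt_atTop 0] with T hT
  have hT' : (0 : ℝ) < T := by exact_mod_cast hT
  have hle : f + (h - M.transOp π h) ≤ r := fun x => by
    have := hr x
    simp only [Pi.add_apply, Pi.sub_apply] at this ⊢
    linarith
  have hsum : (T : ℝ) * f s + (h - (M.transOp π ^ T) h) s
      ≤ (∑ t ∈ Finset.range T, (M.transOp π ^ t) r) s := by
    rw [← sum_transOp_pow_sub, Finset.sum_apply, Finset.sum_apply, ← nsmul_eq_mul,
      ← Finset.card_range T, ← Finset.sum_const, Finset.card_range, ← Finset.sum_add_distrib]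
    refine Finset.sum_le_sum fun t _ => ?_
    have h1 := M.transOp_pow_mono π t hle s
    have h2 := M.le_transOp_pow π t hf s
    rw [map_add, Pi.add_apply] at h1
    linarith
  calc f s + 1 / (T : ℝ) * (h - (M.transOp π ^ T) h) s
      = 1 / (T : ℝ) * ((T : ℝ) * f s + (h - (M.transOp π ^ T) h) s) := by field_simp
    _ ≤ _ := mul_le_mul_of_nonneg_left hsum (by positivity)

lemma cesaro_neg (M : MDP S A) (π : S → A) (r : S → ℝ) (s : S) :
    M.cesaro π (-r) s = fun T => -M.cesaro π r s T := by
  ext T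
  simp [cesaro]

lemma le_of_tendsto_cesaro' (M : MDP S A) (π : S → A) {f h r : S → ℝ} {s : S} {g : ℝ}
    (hf : M.transOp π f ≤ f) (hr : r + M.transOp π h - h ≤ f)
    (hg : Tendsto (M.cesaro π r s) atTop (𝓝 g)) : g ≤ f s := by
  have h1 : (-f) s ≤ -g := by
    refine M.le_of_tendsto_cesaro π (f := -f) (h := -h) (r := -r) ?_ ?_
      (by rw [cesaro_neg]; exact hg.neg)
    · rw [map_neg]
      exact neg_le_neg hf
    · intro x
      have := hr x
      simp only [map_neg, Pi.add_apply, Pi.sub_apply, Pi.neg_apply] at this ⊢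
      linarith
  simpa using h1

lemma exists_tendsto_cesaro (M : MDP S A) (π : S → A) (r : S → ℝ) :
    ∃ g h : S → ℝ, M.transOp π g = g ∧ r = g + h - M.transOp π h ∧
      ∀ s, Tendsto (M.cesaro π r s) atTop (𝓝 (g s)) := by
  obtain ⟨g, h, hg, hr⟩ := M.exists_poisson_decomposition π r
  refine ⟨g, h, hg, hr, fun s => ?_⟩
  have hlim : Tendsto (fun T : ℕ => g s + (1 / (T : ℝ)) * (h - (M.transOp π ^ T) h) s)
      atTop (𝓝 (g s)) := by
    simpa using (M.tendsto_boundary π h s).const_add (g s)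
  refine hlim.congr' ?_
  filter_upwards [eventually_gt_atTop 0] with T hT
  have hT' : (T : ℝ) ≠ 0 := by exact_mod_cast hT.ne'
  have hgn : ∀ n : ℕ, (M.transOp π ^ n) g = g := fun n => by
    induction n with
    | zero => simp
    | succ n ih => rw [pow_succ, Module.End.mul_apply, hg, ih]
  have hsum : ∑ t ∈ Finset.range T, (M.transOp π ^ t) r
      = (T : ℝ) • g + (h - (M.transOp π ^ T) h) := by
    rw [← sum_transOp_pow_sub, hr, add_sub_assoc]
    simp_rw [map_add, hgn, Finset.sum_add_distrib]
    rw [Finset.sum_const, Finset.card_range, Nat.cast_smul_eq_nsmul]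
  rw [cesaro, hsum]
  simp only [Pi.add_apply, Pi.smul_apply, smul_eq_mul]
  field_simp

end TransOp

/-! ### The trajectory law -/

section PathLaw

variable {S A : Type*} [Fintype S] [MeasurableSpace S] [MeasurableSingletonClass S]

instance (M : MDP S A) (π : S → A) (s : S) : IsProbabilityMeasure (M.pathLaw π s) := by
  unfold pathLaw
  infer_instance

lemma integrable_of_history (M : MDP S A) (π : S → A) (s : S) (n : ℕ)
    (F : ((i : Finset.Iic n) → (fun _ : ℕ => S) i) → ℝ) :
    Integrable (fun ω => F (Preorder.frestrictLe n ω)) (M.pathLaw π s) := by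
  classical
  have h : Integrable F ((M.pathLaw π s).map (Preorder.frestrictLe n)) := by
    have := Measure.isProbabilityMeasure_map (μ := M.pathLaw π s)
      (f := Preorder.frestrictLe (π := fun _ : ℕ => S) n) (by fun_prop)
    exact Integrable.of_finite
  exact h.comp_measurable (by fun_prop)

lemma integrable_eval (M : MDP S A) (π : S → A) (s : S) (n : ℕ) (f : S → ℝ) :
    Integrable (fun ω => f (ω n)) (M.pathLaw π s) :=
  M.integrable_of_history π s n fun x => f (x ⟨n, Finset.mem_Iic.2 le_rfl⟩)

lemma integral_toMeasure_trans (M : MDP S A) (s : S) (a : A) (f : S → ℝ) :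
    ∫ x, f x ∂(M.trans s a).toMeasure = ∑ s', M.prob s a s' * f s' := by
  rw [PMF.integral_eq_sum]
  rfl

/-- The Markov property of the trajectory law. -/
lemma integral_history_mul_next (M : MDP S A) (π : S → A) (s : S) (n : ℕ)
    (F : ((i : Finset.Iic n) → (fun _ : ℕ => S) i) → ℝ) (f : S → ℝ) :
    ∫ ω, F (Preorder.frestrictLe n ω) * f (ω (n + 1)) ∂(M.pathLaw π s)
      = ∫ ω, F (Preorder.frestrictLe n ω) * M.transOp π f (ω n) ∂(M.pathLaw π s) := by
  classical
  have hmap := Kernel.partialTraj_compProd_eq_map_traj (X := fun _ => S) (κ := M.stepKernel π)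
    (Nat.zero_le n) (x₀ := fun _ => s)
  rw [← Kernel.traj_map_frestrictLe_apply] at hmap
  have hm : Measurable fun x : ℕ → S =>
      (Preorder.frestrictLe (π := fun _ : ℕ => S) n x, x (n + 1)) := by fun_prop
  have hF : Measurable fun y : ((i : Finset.Iic n) → (fun _ : ℕ => S) i) × S => F y.1 * f y.2 :=
    measurable_of_finite _
  have := Measure.isProbabilityMeasure_map (μ := M.pathLaw π s)
      (f := Preorder.frestrictLe (π := fun _ : ℕ => S) n) (by fun_prop)
  calc ∫ ω, F (Preorder.frestrictLe n ω) * f (ω (n + 1)) ∂(M.pathLaw π s)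
      = ∫ y, F y.1 * f y.2 ∂((M.pathLaw π s).map
          fun x => (Preorder.frestrictLe (π := fun _ : ℕ => S) n x, x (n + 1))) :=
        (integral_map hm.aemeasurable hF.aestronglyMeasurable).symm
    _ = ∫ y, F y.1 * f y.2 ∂(((M.pathLaw π s).map
          (Preorder.frestrictLe (π := fun _ : ℕ => S) n)) ⊗ₘ (M.stepKernel π n)) := by
        rw [pathLaw, hmap]
    _ = ∫ x, ∫ z, F x * f z ∂(M.stepKernel π n x) ∂((M.pathLaw π s).map
          (Preorder.frestrictLe (π := fun _ : ℕ => S) n)) :=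
        Measure.integral_compProd Integrable.of_finite
    _ = ∫ ω, ∫ z, F (Preorder.frestrictLe n ω) * f z
          ∂(M.stepKernel π n (Preorder.frestrictLe n ω)) ∂(M.pathLaw π s) :=
        integral_map (by fun_prop) (measurable_of_finite _).aestronglyMeasurable
    _ = _ := by
        refine integral_congr_ae (Eventually.of_forall fun ω => ?_)
        simp only [integral_const_mul]
        congr 1
        exact M.integral_toMeasure_trans _ _ f

lemma ae_pathLaw_zero (M : MDP S A) (π : S → A) (s : S) : ∀ᵐ ω ∂(M.pathLaw π s), ω 0 = s := by
  have h := Kernel.traj_map_frestrictLe_apply (X := fun _ => S) (κ := M.stepKernel π) 0 0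
    (fun _ => s)
  rw [Kernel.partialTraj_self, Kernel.id_apply] at h
  have h2 : ∀ᵐ x ∂((M.pathLaw π s).map (Preorder.frestrictLe (π := fun _ : ℕ => S) 0)),
      x = fun _ => s := by
    rw [pathLaw, h, ae_dirac_eq]
    rfl
  have h3 := ae_of_ae_map (by fun_prop) h2
  filter_upwards [h3] with ω hω
  exact congrFun hω ⟨0, Finset.mem_Iic.2 le_rfl⟩

lemma integral_eval (M : MDP S A) (π : S → A) (s : S) (n : ℕ) (f : S → ℝ) :
    ∫ ω, f (ω n) ∂(M.pathLaw π s) = (M.transOp π ^ n) f s := by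
  induction n generalizing f with
  | zero =>
    rw [integral_congr_ae (g := fun _ => f s)
      ((M.ae_pathLaw_zero π s).mono fun ω hω => by simp [hω])]
    simp
  | succ n ih =>
    have h := M.integral_history_mul_next π s n (fun _ => 1) f
    simp only [one_mul] at h
    rw [h, ih, pow_succ, Module.End.mul_apply]

lemma avgReward_eq_cesaro (M : MDP S A) (π : S → A) (s : S) :
    M.avgReward π s = M.cesaro π (fun x => M.reward x (π x)) s := by
  ext T
  rw [avgReward, cesaro, integral_finsetSum _ fun t _ =>
    M.integrable_eval π s t fun x => M.reward x (π x), Finset.sum_apply]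
  congr 1
  exact Finset.sum_congr rfl fun t _ => M.integral_eval π s t fun x => M.reward x (π x)

end PathLaw

/-! ### Gains of stationary policies -/

section Gain

variable {S A : Type*} [Fintype S] [MeasurableSpace S] [MeasurableSingletonClass S]

/-- The gain of a stationary policy is a genuine limit, and it comes with a solution of the
(multichain) Poisson equation. -/
lemma exists_gain_poisson (M : MDP S A) (π : S → A) :
    ∃ h : S → ℝ, M.transOp π (M.gain π) = M.gain π ∧
      (fun x => M.reward x (π x)) = M.gain π + h - M.transOp π h ∧
      ∀ s, Tendsto (M.avgReward π s) atTop (𝓝 (M.gain π s)) := by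
  obtain ⟨g, h, hg, hr, hlim⟩ := M.exists_tendsto_cesaro π fun x => M.reward x (π x)
  have hlim' : ∀ s, Tendsto (M.avgReward π s) atTop (𝓝 (g s)) := fun s => by
    rw [avgReward_eq_cesaro]
    exact hlim s
  have hgain : M.gain π = g := funext fun s => (hlim' s).limUnder_eq
  rw [hgain]
  exact ⟨h, hg, hr, hlim'⟩

lemma tendsto_cesaro_gain (M : MDP S A) (π : S → A) (s : S) :
    Tendsto (M.cesaro π (fun x => M.reward x (π x)) s) atTop (𝓝 (M.gain π s)) := by
  obtain ⟨_, -, -, h⟩ := M.exists_gain_poisson π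
  rw [← avgReward_eq_cesaro]
  exact h s

/-- A subharmonic `f` with `f + h ≤ r + P h` is a lower bound for the gain. -/
lemma le_gain (M : MDP S A) (π : S → A) {f h : S → ℝ} (hf : f ≤ M.transOp π f)
    (hr : ∀ x, f x ≤ M.reward x (π x) + M.transOp π h x - h x) : f ≤ M.gain π := fun s =>
  M.le_of_tendsto_cesaro π hf hr (M.tendsto_cesaro_gain π s)

/-- A superharmonic `f` with `r + P h ≤ f + h` is an upper bound for the gain. -/
lemma gain_le (M : MDP S A) (π : S → A) {f h : S → ℝ} (hf : M.transOp π f ≤ f)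
    (hr : ∀ x, M.reward x (π x) + M.transOp π h x - h x ≤ f x) : M.gain π ≤ f := fun s =>
  M.le_of_tendsto_cesaro' π hf hr (M.tendsto_cesaro_gain π s)

lemma gain_le_optGain [Finite A] (M : MDP S A) (π : S → A) : M.gain π M.init ≤ M.optGain :=
  le_ciSup (f := fun π : S → A => M.gain π M.init) (Set.finite_range _).bddAbove π

lemma IsOptimal.gain_init [Finite A] {M : MDP S A} {π : S → A} (hπ : M.IsOptimal π) :
    M.gain π M.init = M.optGain := by
  have : Nonempty (S → A) := ⟨π⟩
  exact le_antisymm (M.gain_le_optGain π) (ciSup_le fun π' => hπ M.init π')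

/-- Policy improvement: if some action `a` in some state `s` increased the expected gain of the
next state, then playing `a` in `s` and following `π` elsewhere would have a larger gain in `s`. -/
lemma IsOptimal.sum_prob_mul_gain_le {M : MDP S A} {π : S → A} (hπ : M.IsOptimal π) (s : S)
    (a : A) : ∑ s', M.prob s a s' * M.gain π s' ≤ M.gain π s := by
  classical
  by_contra! hlt
  obtain ⟨h, hg, hr, -⟩ := M.exists_gain_poisson π
  set g := M.gain π
  set π₂ := Function.update π s a
  have hself : ∀ f, M.transOp π₂ f s = ∑ s', M.prob s a s' * f s' := fun f => by
    simp [transOp_apply, π₂]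
  have hne : ∀ f x, x ≠ s → M.transOp π₂ f x = M.transOp π f x := fun f x hx => by
    simp [transOp_apply, π₂, hx]
  have hsub : g ≤ M.transOp π₂ g := fun x => by
    by_cases hx : x = s
    · rw [hx, hself]
      exact hlt.le
    · rw [hne g x hx, hg]
  have hδ : 0 < M.transOp π₂ g s - g s := by
    rw [hself]
    linarith
  -- Away from `s`, adding a multiple of `g` to `h` does not affect the Poisson equation; at `s`, it
  -- changes the residual by that multiple of the (positive) drift of `g`, so any value is possible.
  set K : ℝ := (M.transOp π₂ g s - M.reward s a - M.transOp π₂ h s + h s)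
    / (M.transOp π₂ g s - g s) with hK
  have hle := M.le_gain π₂ (f := M.transOp π₂ g) (h := h + K • g) (M.transOp_mono π₂ hsub)
    (fun x => by
      rw [map_add, map_smul]
      simp only [Pi.add_apply, Pi.smul_apply, smul_eq_mul]
      by_cases hx : x = s
      · have hKm : K * (M.transOp π₂ g s - g s)
            = M.transOp π₂ g s - M.reward s a - M.transOp π₂ h s + h s :=
          div_mul_cancel₀ _ hδ.ne'
        have : π₂ s = a := by simp [π₂]
        rw [hx, this]
        linarith
      · have h1 := congrFun hr x
        have h2 : π₂ x = π x := by simp [π₂, hx]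
        simp only [Pi.add_apply, Pi.sub_apply] at h1
        rw [hne g x hx, hne h x hx, hg, h2, h1]
        linarith)
  have h3 := hle s
  have h4 := hπ s π₂
  linarith

/-- In a communicating MDP the set where the gain of an optimal policy is minimal is closed under
all transitions, so the gain is constant. -/
lemma IsOptimal.gain_eq_optGain [Finite A] {M : MDP S A} {π : S → A} (hπ : M.IsOptimal π)
    (hM : M.IsCommunicating) (s : S) : M.gain π s = M.optGain := by
  have : Nonempty S := ⟨s⟩
  obtain ⟨m, hm⟩ := Finite.exists_min (M.gain π)
  have hmin : ∀ x, M.gain π x = M.gain π m := fun x => by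
    induction hM m x with
    | refl => rfl
    | @tail y z _ hyz ih =>
      obtain ⟨a, ha⟩ := hyz
      have hle := hπ.sum_prob_mul_gain_le y a
      by_contra hz
      have hzlt : M.gain π m < M.gain π z := lt_of_le_of_ne (hm z) (Ne.symm hz)
      have hlt : ∑ s', M.prob y a s' * M.gain π m < ∑ s', M.prob y a s' * M.gain π s' :=
        Finset.sum_lt_sum
          (fun x _ => mul_le_mul_of_nonneg_left (hm x) (M.prob_nonneg y a x))
          ⟨z, Finset.mem_univ z, mul_lt_mul_of_pos_left hzlt ha⟩
      rw [sum_prob_mul_const] at hlt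
      linarith
  rw [hmin s, ← hmin M.init, hπ.gain_init]

lemma IsOptimal.exists_isBias [Finite A] {M : MDP S A} {π : S → A} (hπ : M.IsOptimal π)
    (hM : M.IsCommunicating) : ∃ h, M.IsBias π h := by
  obtain ⟨h, -, hr, -⟩ := M.exists_gain_poisson π
  refine ⟨h, fun s => ?_⟩
  have h1 := congrFun hr s
  simp only [Pi.add_apply, Pi.sub_apply, hπ.gain_eq_optGain hM, transOp_apply] at h1
  linarith

/-- If `c` is a lower bound for `r' + P' h - h`, then replacing `r'` and `P'` by `r` and `P` costs
at most `Δr` and `L * Δp`, where `L` bounds the span of `h`. -/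
lemma le_gain_of_perturbation (M M' : MDP S A) (π : S → A) {h : S → ℝ} {c L Δr Δp : ℝ}
    (hL : ∀ x y, h x - h y ≤ L)
    (hc : ∀ s, c ≤ M'.reward s (π s) + M'.transOp π h s - h s)
    (hr : ∀ s, |M.reward s (π s) - M'.reward s (π s)| ≤ Δr)
    (hp : ∀ s, transDist M M' s (π s) ≤ Δp) (s : S) :
    c - (L * Δp + Δr) ≤ M.gain π s := by
  refine M.le_gain π (f := fun _ => c - (L * Δp + Δr)) (h := h) ?_ (fun x => ?_) s
  · rw [transOp_const]
  · -- Both rows have total mass one, so `h` may be shifted to vanish at `x`.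
    have hdiff : M'.transOp π h x - M.transOp π h x
        = ∑ s', (M'.prob x (π x) s' - M.prob x (π x) s') * (h s' - h x) := by
      have h1 := M'.sum_prob_mul_const x (π x) (h x)
      have h2 := M.sum_prob_mul_const x (π x) (h x)
      simp only [transOp_apply, sub_mul, mul_sub, Finset.sum_sub_distrib, h1, h2]
      ring
    have hbound : M'.transOp π h x - M.transOp π h x ≤ L * transDist M M' x (π x) := by
      rw [hdiff, transDist, Finset.mul_sum]
      refine Finset.sum_le_sum fun s' _ => (le_abs_self _).trans ?_
      rw [abs_mul, mul_comm, abs_sub_comm (M'.prob _ _ _)]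
      refine mul_le_mul_of_nonneg_right ?_ (abs_nonneg _)
      exact abs_le'.2 ⟨hL _ _, by linarith [hL x s']⟩
    have hL0 : 0 ≤ L := by simpa using hL x x
    have h1 := mul_le_mul_of_nonneg_left (hp x) hL0
    have h2 := (abs_le.1 (hr x)).1
    have h3 := hc x
    linarith

/-- In `M`, the policy `π` earns almost as much as in `M'`, and it is at most as good as an optimal
policy of `M`. -/
lemma optGain_sub_le_of_isBias [Finite A] (M M' : MDP S A) {π : S → A} {h : S → ℝ}
    (hh : M'.IsBias π h) {Δr Δp : ℝ}
    (hr : ∀ s, |M.reward s (π s) - M'.reward s (π s)| ≤ Δr)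
    (hp : ∀ s, transDist M M' s (π s) ≤ Δp) :
    M'.optGain - M.optGain ≤ span h * Δp + Δr := by
  have h1 := M.le_gain_of_perturbation M' π (c := M'.optGain) (sub_le_span h)
    (fun s => by
      have := hh s
      rw [transOp_apply]
      linarith) hr hp M.init
  have h2 := M.gain_le_optGain π
  linarith

end Gain

/-! ### The discounted optimality equation -/

section Discounted

variable {S A : Type*} [Fintype S]

/-- The Bellman operator is a `β`-contraction in the supremum norm; its fixed point is the optimal
discounted value. -/
lemma exists_discounted_value [Finite A] [Nonempty A] (M : MDP S A) {β : ℝ} (h0 : 0 ≤ β)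
    (h1 : β < 1) :
    ∃ v : S → ℝ, (∀ s a, M.reward s a + β * ∑ s', M.prob s a s' * v s' ≤ v s) ∧
      ∃ π : S → A, ∀ s, v s = M.reward s (π s) + β * M.transOp π v s := by
  set q : (S → ℝ) → S → A → ℝ := fun v s a =>
    M.reward s a + β * ∑ s', M.prob s a s' * v s' with hq
  set B : (S → ℝ) → S → ℝ := fun v s => ⨆ a, q v s a with hB
  have hbdd : ∀ v s, BddAbove (Set.range (q v s)) := fun v s => (Set.finite_range _).bddAbove
  have hle : ∀ v w s, B v s ≤ B w s + β * dist v w := fun v w s => by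
    refine ciSup_le fun a => ?_
    have h2 := le_ciSup (hbdd w s) a
    have h3 : ∑ s', M.prob s a s' * v s' ≤ ∑ s', M.prob s a s' * w s' + dist v w := by
      rw [← M.sum_prob_mul_const s a (dist v w), ← Finset.sum_add_distrib]
      refine Finset.sum_le_sum fun x _ => ?_
      rw [← mul_add]
      refine mul_le_mul_of_nonneg_left ?_ (M.prob_nonneg s a x)
      have := (le_abs_self _).trans ((Real.dist_eq (v x) (w x)).ge.trans (dist_le_pi_dist v w x))
      linarith
    have h4 := mul_le_mul_of_nonneg_left h3 h0
    simp only [hB, hq] at h2 ⊢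
    linarith
  have hcontr : ContractingWith ⟨β, h0⟩ B := by
    refine ⟨by exact_mod_cast h1, LipschitzWith.of_dist_le_mul fun v w => ?_⟩
    refine (dist_pi_le_iff (mul_nonneg h0 dist_nonneg)).2 fun s => ?_
    rw [Real.dist_eq, abs_le']
    have h2 := hle v w s
    have h3 := hle w v s
    rw [dist_comm w v] at h3
    exact ⟨by change _ ≤ β * _; linarith, by change _ ≤ β * _; linarith⟩
  have hfix : B (ContractingWith.fixedPoint B hcontr) = ContractingWith.fixedPoint B hcontr :=
    hcontr.fixedPoint_isFixedPt
  set v := ContractingWith.fixedPoint B hcontr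
  refine ⟨v, fun s a => (le_ciSup (hbdd v s) a).trans_eq (congrFun hfix s), ?_⟩
  choose π hπ using fun s => exists_eq_ciSup_of_finite (f := q v s)
  exact ⟨π, fun s => (congrFun hfix s).symm.trans (hπ s).symm⟩

lemma mul_discounted_value_le_one (M : MDP S A) {β : ℝ} (h0 : 0 ≤ β) {v : S → ℝ} {π : S → A}
    (h1 : β < 1) (hv : ∀ s, v s = M.reward s (π s) + β * M.transOp π v s) (s : S) :
    (1 - β) * v s ≤ 1 := by
  have : Nonempty S := ⟨s⟩
  obtain ⟨m, hm⟩ := Finite.exists_max v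
  have h2 : M.transOp π v m ≤ v m := by
    have := M.sum_prob_mul_mono m (π m) hm
    rwa [sum_prob_mul_const] at this
  have h3 := mul_le_mul_of_nonneg_left h2 h0
  have h4 := (M.reward_mem m (π m)).2
  have h5 := hv m
  have h6 := mul_le_mul_of_nonneg_left (hm s) (sub_nonneg.2 h1.le)
  linarith

end Discounted

/-! ### Hitting times and the span of the discounted value -/

section Hitting

variable {S A : Type*}

open Classical in
/-- The indicator that the trajectory avoids `s'` up to and including time `n`. -/
noncomputable def avoids (s' : S) (n : ℕ) (ω : ℕ → S) : ℝ :=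
  if ∀ i ≤ n, ω i ≠ s' then 1 else 0

lemma avoids_eq_history (s' : S) (n : ℕ) :
    ∃ F : ((i : Finset.Iic n) → (fun _ : ℕ => S) i) → ℝ,
      ∀ ω, avoids s' n ω = F (Preorder.frestrictLe n ω) := by
  classical
  refine ⟨fun x => if ∀ i, x i ≠ s' then 1 else 0, fun ω => ?_⟩
  simp [avoids, Preorder.frestrictLe]

lemma avoids_nonneg (s' : S) (n : ℕ) (ω : ℕ → S) : 0 ≤ avoids s' n ω := by
  unfold avoids
  split_ifs <;> norm_num

lemma avoids_mul_eq_succ (s' : S) (n : ℕ) (ω : ℕ → S) {w : S → ℝ} (hw : w s' = 0) :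
    avoids s' n ω * w (ω (n + 1)) = avoids s' (n + 1) ω * w (ω (n + 1)) := by
  classical
  by_cases h : ω (n + 1) = s'
  · rw [h, hw, mul_zero, mul_zero]
  · have : (∀ i ≤ n + 1, ω i ≠ s') ↔ ∀ i ≤ n, ω i ≠ s' := by
      refine ⟨fun H i hi => H i (by omega), fun H i hi => ?_⟩
      rcases Nat.le_succ_iff.1 hi with hi | rfl
      · exact H i hi
      · exact h
    have heq : avoids s' (n + 1) ω = avoids s' n ω := by
      unfold avoids
      exact if_congr this rfl rfl
    rw [heq]

lemma ofReal_sum_avoids_le_hittingTime (s' : S) (N : ℕ) (ω : ℕ → S) :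
    ENNReal.ofReal (∑ n ∈ Finset.range N, avoids s' n ω) ≤ hittingTime s' ω := by
  classical
  refine le_iInf₂ fun k hk => ?_
  rw [← ENNReal.ofReal_natCast]
  refine ENNReal.ofReal_le_ofReal ?_
  have hle : ∀ n, avoids s' n ω ≤ if n < k then 1 else 0 := fun n => by
    by_cases hn : n < k
    · rw [if_pos hn, avoids]
      split_ifs <;> norm_num
    · rw [if_neg hn, avoids, if_neg fun H => H k (not_lt.1 hn) hk]
  refine (Finset.sum_le_sum fun n _ => hle n).trans ?_
  rw [Finset.sum_boole]
  have : (Finset.range N).filter (· < k) ⊆ Finset.range k := fun x hx => by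
    simpa using (Finset.mem_filter.1 hx).2
  exact_mod_cast (Finset.card_le_card this).trans_eq (Finset.card_range k)

variable [Fintype S] [MeasurableSpace S] [MeasurableSingletonClass S]

lemma integrable_avoids_mul (M : MDP S A) (π : S → A) (s s' : S) (n : ℕ) (f : S → ℝ) :
    Integrable (fun ω => avoids s' n ω * f (ω n)) (M.pathLaw π s) := by
  obtain ⟨F, hF⟩ := avoids_eq_history s' n
  simp_rw [hF]
  exact M.integrable_of_history π s n fun x => F x * f (x ⟨n, Finset.mem_Iic.2 le_rfl⟩)

lemma integrable_avoids (M : MDP S A) (π : S → A) (s s' : S) (n : ℕ) :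
    Integrable (avoids s' n) (M.pathLaw π s) := by
  simpa using M.integrable_avoids_mul π s s' n fun _ => 1

/-- A function that vanishes at `s'` and drops by at most one (after discounting) per step is
bounded by the expected time to reach `s'`. -/
lemma ofReal_le_lintegral_hittingTime (M : MDP S A) (π : S → A) {β : ℝ} (h0 : 0 ≤ β) (h1 : β < 1)
    {w : S → ℝ} {s' : S} (hw0 : ∀ x, 0 ≤ w x) (hw' : w s' = 0)
    (hw : ∀ x, x ≠ s' → w x ≤ 1 + β * M.transOp π w x) (s : S) :
    ENNReal.ofReal (w s) ≤ ∫⁻ ω, hittingTime s' ω ∂(M.pathLaw π s) := by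
  set μ := M.pathLaw π s
  have hint := M.integrable_avoids π s s'
  have hintm := M.integrable_avoids_mul π s s'
  have hstep : ∀ n, ∫ ω, avoids s' n ω * w (ω n) ∂μ
      ≤ ∫ ω, avoids s' n ω ∂μ + β * ∫ ω, avoids s' (n + 1) ω * w (ω (n + 1)) ∂μ := fun n => by
    obtain ⟨F, hF⟩ := avoids_eq_history s' n
    have hnext : ∫ ω, avoids s' (n + 1) ω * w (ω (n + 1)) ∂μ
        = ∫ ω, avoids s' n ω * M.transOp π w (ω n) ∂μ := by
      simp_rw [← avoids_mul_eq_succ s' n _ hw', hF]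
      exact M.integral_history_mul_next π s n F w
    rw [hnext, ← integral_const_mul, ← integral_add (hint n) ((hintm n _).const_mul β)]
    refine integral_mono (hintm n w) ((hint n).add ((hintm n _).const_mul β)) fun ω => ?_
    by_cases hω : ω n = s'
    · have : avoids s' n ω = 0 := if_neg fun H => H n le_rfl hω
      simp [this]
    · have := mul_le_mul_of_nonneg_left (hw _ hω) (avoids_nonneg s' n ω)
      linarith
  have hiter : ∀ N, w s ≤ ∫ ω, ∑ n ∈ Finset.range N, avoids s' n ω ∂μ
      + β ^ N * ∫ ω, avoids s' N ω * w (ω N) ∂μ := fun N => by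
    induction N with
    | zero =>
      have : ∀ᵐ ω ∂μ, avoids s' 0 ω * w (ω 0) = w s := by
        filter_upwards [M.ae_pathLaw_zero π s] with ω hω
        by_cases hs : s = s'
        · simp [hω, hs, hw']
        · simp [avoids, hω, hs]
      rw [integral_congr_ae this]
      simp
    | succ N ih =>
      have h2 := mul_le_mul_of_nonneg_left (hstep N) (pow_nonneg h0 N)
      have h3 : β ^ N * ∫ ω, avoids s' N ω ∂μ ≤ ∫ ω, avoids s' N ω ∂μ :=
        mul_le_of_le_one_left (integral_nonneg (avoids_nonneg s' N)) (pow_le_one₀ h0 h1.le)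
      have h4 : ∫ ω, ∑ n ∈ Finset.range (N + 1), avoids s' n ω ∂μ
          = ∫ ω, ∑ n ∈ Finset.range N, avoids s' n ω ∂μ + ∫ ω, avoids s' N ω ∂μ := by
        simp_rw [Finset.sum_range_succ]
        exact integral_add (integrable_finsetSum _ fun n _ => hint n) (hint N)
      rw [h4, pow_succ]
      linarith
  have hbound : ∀ N, ∫ ω, avoids s' N ω * w (ω N) ∂μ ≤ ‖w‖ := fun N => by
    refine (integral_mono (hintm N w) (integrable_const ‖w‖) fun ω => ?_).trans_eq (by simp)
    have h2 : w (ω N) ≤ ‖w‖ := (le_abs_self _).trans (norm_le_pi_norm w (ω N))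
    refine (mul_le_of_le_one_left (hw0 _) ?_).trans h2
    unfold avoids
    split_ifs <;> norm_num
  have hlim : Tendsto (fun N : ℕ => ENNReal.ofReal (w s - β ^ N * ‖w‖)) atTop
      (𝓝 (ENNReal.ofReal (w s))) := by
    refine ENNReal.tendsto_ofReal ?_
    simpa using ((tendsto_pow_atTop_nhds_zero_of_lt_one h0 h1).mul_const ‖w‖).const_sub (w s)
  refine le_of_tendsto' hlim fun N => ?_
  calc ENNReal.ofReal (w s - β ^ N * ‖w‖)
      ≤ ENNReal.ofReal (∫ ω, ∑ n ∈ Finset.range N, avoids s' n ω ∂μ) := by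
        refine ENNReal.ofReal_le_ofReal ?_
        have := mul_le_mul_of_nonneg_left (hbound N) (pow_nonneg h0 N)
        linarith [hiter N]
    _ = ∫⁻ ω, ENNReal.ofReal (∑ n ∈ Finset.range N, avoids s' n ω) ∂μ :=
        ofReal_integral_eq_lintegral_ofReal (integrable_finsetSum _ fun n _ => hint n)
          (Eventually.of_forall fun ω => Finset.sum_nonneg fun n _ => avoids_nonneg s' n ω)
    _ ≤ ∫⁻ ω, hittingTime s' ω ∂μ := lintegral_mono (ofReal_sum_avoids_le_hittingTime s' N)

/-- Going from `s` to `s'` before collecting the value of `s'` costs at most one unit of reward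
per step, so the span of the discounted value is at most the diameter, for every discount
factor. -/
lemma discounted_value_sub_le (M : MDP S A) {D : ℝ≥0} (hD : M.diameter ≤ D) {β : ℝ} (h0 : 0 ≤ β)
    (h1 : β < 1) {v : S → ℝ} (hle : ∀ s a, M.reward s a + β * ∑ s', M.prob s a s' * v s' ≤ v s)
    (hone : ∀ s, (1 - β) * v s ≤ 1) (s' s : S) : v s' - v s ≤ D := by
  by_cases hs : s = s'
  · simp [hs]
  set w : S → ℝ := fun x => max (v s' - v x) 0 with hw
  have hhit : ∀ π : S → A, ENNReal.ofReal (w s) ≤ ∫⁻ ω, hittingTime s' ω ∂(M.pathLaw π s) :=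
    fun π => by
      refine M.ofReal_le_lintegral_hittingTime π (w := w) h0 h1 (fun x => le_max_right _ _)
        (by simp [hw]) (fun x _ => ?_) s
      have hnn : 0 ≤ M.transOp π w x :=
        Finset.sum_nonneg fun y _ => mul_nonneg (M.prob_nonneg x (π x) y) (le_max_right _ _)
      have hge : v s' - M.transOp π v x ≤ M.transOp π w x := by
        have := M.sum_prob_mul_mono x (π x) (f := fun y => v s' - v y) (g := w)
          fun y => le_max_left _ _
        simp only [mul_sub, Finset.sum_sub_distrib, sum_prob_mul_const] at this
        exact this
      have h2 := mul_le_mul_of_nonneg_left hge h0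
      have h3 := hle x (π x)
      have h4 := (M.reward_mem x (π x)).1
      have h5 := hone s'
      rw [transOp_apply] at h2
      exact max_le (by linarith) (by positivity)
  have hdiam : ⨅ π : S → A, ∫⁻ ω, hittingTime s' ω ∂(M.pathLaw π s) ≤ M.diameter :=
    le_iSup_of_le s (le_iSup_of_le s' (le_iSup_of_le hs le_rfl))
  have hfin := ((le_iInf hhit).trans hdiam).trans hD
  rw [← ENNReal.ofReal_coe_nnreal, ENNReal.ofReal_le_ofReal_iff D.coe_nonneg] at hfin
  exact (le_max_left _ _).trans hfin

end Hitting

/-! ### Variation of the optimal gain -/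

section Variation

variable {S A : Type*} [Fintype S] [MeasurableSpace S] [MeasurableSingletonClass S]

/-- The discounted value `v` satisfies `r + P v - v = (1 - β) P v` under a greedy policy, and `≤`
under every policy. As `v` varies by at most `D`, this makes `v` an approximate bias function, with
error `(1 - β) D` that vanishes as `β → 1`. -/
lemma optGain_sub_le_of_diameter_le [Finite A] [Nonempty A] (M M' : MDP S A)
    {D : ℝ≥0} (hD : M'.diameter ≤ D) {Δr Δp : ℝ}
    (hr : ∀ s a, |M.reward s a - M'.reward s a| ≤ Δr)
    (hp : ∀ s a, transDist M M' s a ≤ Δp) :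
    M'.optGain - M.optGain ≤ D * Δp + Δr := by
  have key : ∀ β : ℝ, 0 ≤ β → β < 1 →
      M'.optGain - M.optGain ≤ D * Δp + Δr + (1 - β) * D := fun β h0 h1 => by
    obtain ⟨v, hle, π, hv⟩ := M'.exists_discounted_value h0 h1
    have hspan : ∀ x y, v x - v y ≤ D :=
      M'.discounted_value_sub_le hD h0 h1 hle (M'.mul_discounted_value_le_one h0 h1 hv)
    have : Nonempty S := ⟨M.init⟩
    obtain ⟨m, hm⟩ := Finite.exists_max v
    have hβ : 0 ≤ 1 - β := sub_nonneg.2 h1.le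
    have hup : M'.optGain ≤ (1 - β) * v m := ciSup_le fun π' => by
      refine M'.gain_le π' (f := fun _ => (1 - β) * v m) (h := v) (by rw [transOp_const])
        (fun x => ?_) M'.init
      have h2 : M'.transOp π' v x ≤ v m := by
        have := M'.sum_prob_mul_mono x (π' x) hm
        rwa [sum_prob_mul_const] at this
      have h3 := mul_le_mul_of_nonneg_left h2 hβ
      have h4 := hle x (π' x)
      rw [← transOp_apply] at h4
      linarith
    have hlow := M.le_gain_of_perturbation M' π (c := (1 - β) * (v m - D)) hspan
      (fun x => by
        have h2 : v m - D ≤ M'.transOp π v x := by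
          have := M'.sum_prob_mul_mono x (π x) (f := fun _ => v m - D) (g := v)
            fun y => by linarith [hspan m y]
          rwa [sum_prob_mul_const] at this
        have h3 := mul_le_mul_of_nonneg_left h2 hβ
        have h4 := hv x
        linarith) (fun s => hr s (π s)) (fun s => hp s (π s)) M.init
    have h2 := M.gain_le_optGain π
    linarith
  have hlim : Tendsto (fun β : ℝ => D * Δp + Δr + (1 - β) * D) (𝓝[<] 1)
      (𝓝 (D * Δp + Δr)) := by
    have : Continuous fun β : ℝ => D * Δp + Δr + (1 - β) * (D : ℝ) := by fun_prop
    simpa using (this.tendsto 1).mono_left nhdsWithin_le_nhds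
  refine ge_of_tendsto hlim ?_
  filter_upwards [Ioo_mem_nhdsLT (zero_lt_one' ℝ)] with β hβ
  exact key β hβ.1.le hβ.2

lemma abs_optGain_sub_le [Finite A] [Nonempty A] (M M' : MDP S A)
    {D : ℝ≥0} (hD : M.diameter ≤ D) (hD' : M'.diameter ≤ D) :
    |M'.optGain - M.optGain| ≤ (⨆ x : S × A, |M'.reward x.1 x.2 - M.reward x.1 x.2|)
      + D * ⨆ x : S × A, transDist M' M x.1 x.2 := by
  have hr : ∀ s a, |M'.reward s a - M.reward s a|
      ≤ ⨆ x : S × A, |M'.reward x.1 x.2 - M.reward x.1 x.2| := fun s a =>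
    le_ciSup (f := fun x : S × A => |M'.reward x.1 x.2 - M.reward x.1 x.2|)
      (Set.finite_range _).bddAbove (s, a)
  have hp : ∀ s a, transDist M' M s a ≤ ⨆ x : S × A, transDist M' M x.1 x.2 := fun s a =>
    le_ciSup (f := fun x : S × A => transDist M' M x.1 x.2) (Set.finite_range _).bddAbove (s, a)
  have h1 := M.optGain_sub_le_of_diameter_le M' hD'
    (fun s a => (abs_sub_comm _ _).trans_le (hr s a))
    (fun s a => (transDist_comm M M' s a).trans_le (hp s a))
  have h2 := M'.optGain_sub_le_of_diameter_le M hD hr hp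
  exact abs_le'.2 ⟨by linarith, by linarith⟩

end Variation

end MDP

theorem mainTheorem3 {S A : Type*} [Fintype S] [MeasurableSpace S] [MeasurableSingletonClass S]
    [Fintype A] [Nonempty A] :
    -- the limit that defines the average reward of a stationary policy exists
    (∀ (M : MDP S A) (π : S → A) (s : S), ∃ g : ℝ, Tendsto (M.avgReward π s) atTop (𝓝 g)) ∧
    -- the bound on the variation of the optimal average rewards
    (∀ (T : ℕ) (M : ℕ → MDP S A) (s₁ : S) (D : ℝ≥0),
      (∀ t ∈ Finset.Icc 1 T, (M t).init = s₁) →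
      (∀ t ∈ Finset.Icc 1 T, (M t).IsCommunicating) →
      (∀ t ∈ Finset.Icc 1 T, (M t).diameter ≤ (D : ℝ≥0∞)) →
      MDP.gainVariation M T ≤ MDP.rewardVariation M T + D * MDP.transVariation M T) ∧
    -- the perturbation bound for two communicating MDPs
    (∀ (M M' : MDP S A), M.init = M'.init → M.IsCommunicating → M'.IsCommunicating →
      ∀ π' : S → A, M'.IsOptimal π' →
        (∃ h' : S → ℝ, M'.IsBias π' h') ∧
        ∀ h' : S → ℝ, M'.IsBias π' h' → ∀ Δr Δp : ℝ,
          (∀ s, |M.reward s (π' s) - M'.reward s (π' s)| ≤ Δr) →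
          (∀ s, MDP.transDist M M' s (π' s) ≤ Δp) →
          M'.optGain - M.optGain ≤ MDP.span h' * Δp + Δr) := by
  refine ⟨fun M π s => ?_, fun T M s₁ D _ _ hD => ?_, fun M M' _ _ hM' π' hπ' =>
    ⟨hπ'.exists_isBias hM', fun h' hh' Δr Δp hr hp => M.optGain_sub_le_of_isBias M' hh' hr hp⟩⟩
  · obtain ⟨_, -, -, h⟩ := M.exists_gain_poisson π
    exact ⟨_, h s⟩
  · rw [MDP.gainVariation, MDP.rewardVariation, MDP.transVariation, Finset.mul_sum,
      ← Finset.sum_add_distrib]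
    refine Finset.sum_le_sum fun t ht => ?_
    obtain ⟨h1, h2⟩ := Finset.mem_Ico.1 ht
    have ht0 : t ∈ Finset.Icc 1 T := Finset.mem_Icc.2 ⟨h1, h2.le⟩
    have ht1 : t + 1 ∈ Finset.Icc 1 T := Finset.mem_Icc.2 ⟨by omega, h2⟩
    exact (M t).abs_optGain_sub_le (M (t + 1))  (hD t ht0) (hD _ ht1)
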